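/- Let $M\cong\mathbb Z^n$ be a lattice, $M_{\mathbb R}=M\otimes_{\mathbb Z}\mathbb R$, and let $\mathrm{vol}_n$ be Lebesgue (Haar) measure on $M_{\mathbb R}$ normalised so that a fundamental domain of $M$ has volume $1$. Let $\Box\subset M_{\mathbb R}$ be an $n$-dimensional simple convex lattice polytope, that is, a bounded intersection of finitely many closed affine half-spaces, with non-empty interior, whose set of extreme points $\mathrm{ext}\,\Box$ is contained in $M$, and such that for each $\alpha\in\mathrm{ext}\,\Box$ the tangent cone $C_\alpha=\{r(v-\alpha): r\ge 0,\ v\in\Box\}$ is simplicial (generated by linearly independent vectors). For $\alpha\in\mathrm{ext}\,\Box$ let $\lambda_\alpha^1,\dots,\lambda_\alpha^n$ be the edge vectors of $\Box$ at $\alpha$, i.e. the shortest non-zero vectors of $M$ on the extreme rays of $C_\alpha$; put $$Q_\alpha=\Big\{\sum_{i} a_i\lambda_\alpha^i : 0\le a_i<1\Big\}$$ and let $|K_\alpha|=\#(Q_\alpha\cap M)$ (the order of the singularity of $\Box$ at $\alpha$). Let $\zeta$ be a linear form on $M_{\mathbb R}$ that is generic, i.e. $\langle\zeta,\lambda_\alpha^i\rangle\neq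 0$ for all $\alpha\in\mathrm{ext}\,\Box$ and all $i$. Then $\mathrm{ext}\,\Box$ is finite, there are exactly $n$ edge vectors at every $\alpha\in\mathrm{ext}\,\Box$, every $Q_\alpha\cap M$ is finite, and $$\mathrm{vol}_n(\Box)=\frac{(-1)^n}{n!}\sum_{\alpha\in\mathrm{ext}\,\Box}\frac{\langle\zeta,\alpha\rangle^n\,|K_\alpha|}{\langle\zeta,\lambda_\alpha^1\rangle\cdots\langle\zeta,\lambda_\alpha^n\rangle}.$$ -/

import Mathlib

open MeasureTheory

namespace LatticePolytope

variable {E : Type*} [NormedAddCommGroup E] [NormedSpace ℝ E]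

/-- A convex polytope: a bounded intersection of finitely many closed affine half-spaces. -/
def IsConvexPolytope (P : Set E) : Prop :=
  Bornology.IsBounded P ∧
    ∃ H : Finset (Module.Dual ℝ E × ℝ), P = {x | ∀ h ∈ H, h.1 x ≤ h.2}

/-- The tangent cone of `P` at `α`: the cone generated by `P - α`. By `mem_tangentCone_iff`, for
convex `P ∋ α` this is `{r (v - α) : r ≥ 0, v ∈ P}`. -/
def tangentCone (P : Set E) (α : E) : PointedCone ℝ E :=
  PointedCone.hull ℝ ((fun v => v - α) '' P)

theorem mem_tangentCone_iff {P : Set E} (hP : Convex ℝ P) {α : E} (hα : α ∈ P) (x : E) :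
    x ∈ tangentCone P α ↔ ∃ r : ℝ, 0 ≤ r ∧ ∃ v ∈ P, x = r • (v - α) := by
  constructor
  · intro hx
    induction hx using Submodule.span_induction with
    | mem x hx =>
      obtain ⟨v, hv, rfl⟩ := hx
      exact ⟨1, zero_le_one, v, hv, by simp⟩
    | zero => exact ⟨0, le_rfl, α, hα, by simp⟩
    | add x y _ _ ihx ihy =>
      obtain ⟨r, hr, v, hv, rfl⟩ := ihx
      obtain ⟨s, hs, w, hw, rfl⟩ := ihy
      rcases (add_nonneg hr hs).eq_or_lt with h | h
      · have h1 : r = 0 := by linarith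
        have h2 : s = 0 := by linarith
        exact ⟨0, le_rfl, α, hα, by simp [h1, h2]⟩
      · refine ⟨r + s, h.le, (r / (r + s)) • v + (s / (r + s)) • w,
          hP hv hw (by positivity) (by positivity) (by field_simp), ?_⟩
        have e : (r + s) • ((r / (r + s)) • v + (s / (r + s)) • w) = r • v + s • w := by
          rw [smul_add, smul_smul, smul_smul, mul_div_cancel₀ _ h.ne', mul_div_cancel₀ _ h.ne']
        rw [smul_sub (r + s), e]
        module
    | smul a x _ ih =>
      obtain ⟨r, hr, v, hv, rfl⟩ := ih
      exact ⟨(a : ℝ) * r, mul_nonneg a.2 hr, v, hv, by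
        rw [mul_smul]; rfl⟩
  · rintro ⟨r, hr, v, hv, rfl⟩
    exact (tangentCone P α).smul_mem hr (Submodule.subset_span ⟨v, hv, rfl⟩)

/-- A simple convex polytope on the lattice `L`, of full dimension: all extreme points lie in `L`,
and the tangent cone at each of them is simplicial. -/
structure IsSimpleLatticePolytope (L : Submodule ℤ E) (P : Set E) : Prop where
  isConvexPolytope : IsConvexPolytope P
  extremePoints_subset : P.extremePoints ℝ ⊆ (L : Set E)
  nonempty_interior : (interior P).Nonempty
  isSimplicial : ∀ α ∈ P.extremePoints ℝ, (tangentCone P α).IsSimplicial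

/-- The edge vectors of `P` at `α`: the shortest nonzero lattice vectors on the extreme rays of
the tangent cone at `α`. -/
def edgeVectors (L : Submodule ℤ E) (P : Set E) (α : E) : Set E :=
  {l | l ∈ L ∧ l ≠ 0 ∧ (PointedCone.hull ℝ {l}).IsFaceOf (tangentCone P α) ∧
    ∀ r : ℝ, 0 < r → r • l ∈ L → 1 ≤ r}

/-- The semi-open unit parallelepiped `Q_α = {∑ a_i λ_α^i : 0 ≤ a_i < 1}` on the edge vectors. -/
def unitParallelepiped (L : Submodule ℤ E) (P : Set E) (α : E) : Set E :=
  {x | ∃ a : E → ℝ, (∀ l, 0 ≤ a l ∧ a l < 1) ∧ x = ∑ᶠ l ∈ edgeVectors L P α, a l • l}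

/-- The order `|K_α|` of the singularity of `P` at `α`: the number of lattice points of `Q_α`. -/
noncomputable def singularityOrder (L : Submodule ℤ E) (P : Set E) (α : E) : ℕ :=
  (unitParallelepiped L P α ∩ (L : Set E)).ncard

/-- A linear form `ζ` is generic for `P` if it vanishes on no edge vector. -/
def IsGeneric (L : Submodule ℤ E) (P : Set E) (ζ : Module.Dual ℝ E) : Prop :=
  ∀ α ∈ P.extremePoints ℝ, ∀ l ∈ edgeVectors L P α, ζ l ≠ 0

end LatticePolytope

/-! The indicator of `P` decomposes into signed half-open cones at the vertices (the
Lawrence–Varchenko decomposition). At each vertex the edges on which `ζ` is negative are reversed,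
with a factor -1 per reversal; by `sum_indicator_flippedCone` the signed sum is the indicator of `P`
at every point, with no exceptional null set.

The heart is that the sum at a fixed `x` does not depend on `ζ`. Inclusion-exclusion turns each cone
indicator into terms indexed by sets of edges at the vertex, that is, by faces listed at their
`ζ`-maximal vertex. Whether a face contributes depends on the face and `x` alone (`IsInwardFace`),
and its sign is (-1)^dim. So for `x` outside `P` one may replace `ζ` by a generic form that is
smaller at `x` than at every vertex, and then no flipped cone contains `x`. For `x` in `P` only the
unflipped cone, at the `ζ`-minimal vertex, contains `x`.

After flipping, `ζ ≥ ζ α` on the cone at `α`, so `ζ ≤ c` cuts it to a simplex of volume proportional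
to `(c - ζ α) ^ n`. The total is a polynomial in `c` equal to vol `P` for all large `c`, hence for
all `c`; `c = 0` gives the formula. The parallelepiped on the edge vectors has volume `|K_α|`, the
index of the sublattice they span. -/

namespace LatticePolytope

/-! ### Faces of a polytope in coordinates at a simple vertex -/

section

variable {E : Type*} [NormedAddCommGroup E] [NormedSpace ℝ E] {ι : Type*}

/-- A face of `P`: a nonempty closed convex extreme subset. -/
structure IsFace (P F : Set E) : Prop where
  isExtreme : IsExtreme ℝ P F
  convex : Convex ℝ F
  isClosed : IsClosed F
  nonempty : F.Nonempty

/-- The basis `b` spans the tangent cone of `P` at `α`. -/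
def IsConeBasis (P : Set E) (α : E) (b : Module.Basis ι ℝ E) : Prop :=
  ∀ v, v ∈ tangentCone P α ↔ ∀ i, 0 ≤ b.repr v i

theorem add_smul_mem_of_le {F : Set E} (hF : Convex ℝ F) {α v : E} (hα : α ∈ F) {ε δ : ℝ}
    (hε : α + ε • v ∈ F) (hδ : 0 ≤ δ) (h : δ ≤ ε) : α + δ • v ∈ F := by
  rcases hδ.eq_or_lt with rfl | hδ
  · simpa using hα
  have hε0 : 0 < ε := hδ.trans_le h
  have := hF.add_smul_mem hα hε (t := δ / ε) ⟨by positivity, (div_le_one hε0).2 h⟩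
  rwa [smul_smul, div_mul_cancel₀ _ hε0.ne'] at this

theorem exists_pos_add_smul_mem {P : Set E} (hP : Convex ℝ P) {α v : E} (hα : α ∈ P)
    (hv : v ∈ tangentCone P α) : ∃ ε : ℝ, 0 < ε ∧ α + ε • v ∈ P := by
  obtain ⟨r, hr, y, hy, rfl⟩ := (mem_tangentCone_iff hP hα v).1 hv
  refine ⟨1 / (r + 1), by positivity, ?_⟩
  rw [smul_smul]
  refine hP.add_smul_mem hα (by simpa using hy) ⟨by positivity, ?_⟩
  rw [div_mul_eq_mul_div, one_mul, div_le_one (by positivity)]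
  linarith

theorem exists_pos_add_smul_add_mem {F : Set E} (hF : Convex ℝ F) {α v w : E} (hα : α ∈ F)
    (hv : ∃ ε : ℝ, 0 < ε ∧ α + ε • v ∈ F) (hw : ∃ ε : ℝ, 0 < ε ∧ α + ε • w ∈ F) :
    ∃ ε : ℝ, 0 < ε ∧ α + ε • (v + w) ∈ F := by
  obtain ⟨ε, hε, hv⟩ := hv
  obtain ⟨δ, hδ, hw⟩ := hw
  have h1 := add_smul_mem_of_le hF hα hv (le_min hε.le hδ.le) (min_le_left _ _)
  have h2 := add_smul_mem_of_le hF hα hw (le_min hε.le hδ.le) (min_le_right _ _)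
  refine ⟨min ε δ / 2, by positivity, ?_⟩
  convert hF h1 h2 (a := 1 / 2) (b := 1 / 2) (by norm_num) (by norm_num) (by norm_num) using 1
  module

theorem sub_mem_tangentCone {P : Set E} {α y : E} (hy : y ∈ P) : y - α ∈ tangentCone P α :=
  Submodule.subset_span ⟨y, hy, rfl⟩

theorem IsConeBasis.repr_nonneg {P : Set E} {α : E} {b : Module.Basis ι ℝ E}
    (hb : IsConeBasis P α b) {y : E} (hy : y ∈ P) (i : ι) : 0 ≤ b.repr (y - α) i :=
  (hb _).1 (sub_mem_tangentCone hy) i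

/-- The face of `P` at the vertex `α` in the directions `J`. -/
def faceAt (P : Set E) (α : E) (b : Module.Basis ι ℝ E) (J : Finset ι) : Set E :=
  {y ∈ P | ∀ i ∉ J, b.repr (y - α) i = 0}

theorem mem_faceAt_self {P : Set E} {α : E} (hα : α ∈ P) (b : Module.Basis ι ℝ E)
    (J : Finset ι) : α ∈ faceAt P α b J :=
  ⟨hα, by simp⟩

/-- Coordinates at `α` are nonnegative on `P`, so one that vanishes inside a segment vanishes at
both ends. -/
theorem isFace_faceAt [FiniteDimensional ℝ E] {P : Set E} (hP : Convex ℝ P) (hc : IsClosed P)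
    {α : E} (hα : α ∈ P) {b : Module.Basis ι ℝ E} (hb : IsConeBasis P α b) (J : Finset ι) :
    IsFace P (faceAt P α b J) where
  isExtreme := by
    refine ⟨fun y hy => hy.1, fun x hx y hy z hz ⟨s, t, hs, ht, hst, hxyz⟩ => ⟨hx, fun i hi => ?_⟩⟩
    have h1 := hz.2 i hi
    have h2 : z - α = s • (x - α) + t • (y - α) := by
      rw [← hxyz, smul_sub, smul_sub, sub_add_sub_comm, ← add_smul, hst, one_smul]
    rw [h2] at h1
    simp only [map_add, map_smul, Finsupp.add_apply, Finsupp.smul_apply, smul_eq_mul] at h1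
    have h3 := mul_nonneg hs.le (hb.repr_nonneg hx i)
    have h4 := mul_nonneg ht.le (hb.repr_nonneg hy i)
    have h5 : s * b.repr (x - α) i = 0 := by linarith
    exact (mul_eq_zero.1 h5).resolve_left hs.ne'
  convex := by
    intro x hx y hy s t hs ht hst
    refine ⟨hP hx.1 hy.1 hs ht hst, fun i hi => ?_⟩
    have h2 : s • x + t • y - α = s • (x - α) + t • (y - α) := by
      rw [smul_sub, smul_sub, sub_add_sub_comm, ← add_smul, hst, one_smul]
    simp only [h2, map_add, map_smul, Finsupp.add_apply, Finsupp.smul_apply, hx.2 i hi, hy.2 i hi,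
      smul_zero, add_zero]
  isClosed := by
    have : faceAt P α b J = P ∩ ⋂ i ∈ (Jᶜ : Set ι), {y | b.coord i (y - α) = 0} := by
      ext y; simp [faceAt]
    rw [this]
    refine hc.inter (isClosed_biInter fun i _ => isClosed_eq ?_ continuous_const)
    exact (b.coord i).continuous_of_finiteDimensional.comp (continuous_id.sub continuous_const)
  nonempty := ⟨α, mem_faceAt_self hα b J⟩

variable [Fintype ι]

open Classical in
/-- The basis directions along which `F` extends from `α`. -/
noncomputable def faceDirections (b : Module.Basis ι ℝ E) (α : E) (F : Set E) : Finset ι :=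
  Finset.univ.filter fun i => ∃ ε : ℝ, 0 < ε ∧ α + ε • b i ∈ F

theorem mem_faceDirections {b : Module.Basis ι ℝ E} {α : E} {F : Set E} {i : ι} :
    i ∈ faceDirections b α F ↔ ∃ ε : ℝ, 0 < ε ∧ α + ε • b i ∈ F := by
  simp [faceDirections]

/-- A face through the vertex `α` consists of the points of `P` reached from `α` along the
directions of that face. -/
theorem IsFace.mem_iff {P F : Set E} (hP : Convex ℝ P) (hF : IsFace P F) {α : E} (hα : α ∈ F)
    {b : Module.Basis ι ℝ E} (hb : IsConeBasis P α b) {y : E} (hy : y ∈ P) :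
    y ∈ F ↔ ∀ i ∉ faceDirections b α F, b.repr (y - α) i = 0 := by
  classical
  have hαP := hF.isExtreme.subset hα
  constructor
  · intro hyF i hi
    by_contra hne
    have hpos : 0 < b.repr (y - α) i := lt_of_le_of_ne (hb.repr_nonneg hy i) (Ne.symm hne)
    -- Split `y - α` into its `i`-component `v` and the rest `w`, both in the cone. The midpoint of
    -- `α + τ v` and `α + τ w` lies on the segment from `α` to `y`, hence in `F`, so extremality
    -- puts `α + τ v` in `F`. The bound `τ ≤ 2` keeps that midpoint on the segment.
    set v := b.repr (y - α) i • b i with hv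
    set w := (y - α) - v with hw
    have hvC : v ∈ tangentCone P α := by
      rw [hb]; intro j
      rw [hv, map_smul, b.repr_self, Finsupp.smul_apply, Finsupp.single_apply]
      split_ifs
      · simpa only [smul_eq_mul, mul_one] using hpos.le
      · rw [smul_zero]
    have hwC : w ∈ tangentCone P α := by
      rw [hb]; intro j
      rw [hw, hv, map_sub, map_smul, b.repr_self, Finsupp.sub_apply, Finsupp.smul_apply,
        Finsupp.single_apply]
      split_ifs with h
      · subst h; simp
      · simpa using hb.repr_nonneg hy j
    obtain ⟨ε, hε, hvP⟩ := exists_pos_add_smul_mem hP hαP hvC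
    obtain ⟨δ, hδ, hwP⟩ := exists_pos_add_smul_mem hP hαP hwC
    set τ := min (min ε δ) 2 with hτ
    have hτ0 : 0 < τ := by positivity
    have h1 := add_smul_mem_of_le hP hαP hvP hτ0.le
      ((min_le_left _ _).trans (min_le_left _ _))
    have h2 := add_smul_mem_of_le hP hαP hwP hτ0.le
      ((min_le_left _ _).trans (min_le_right _ _))
    have h3 : α + (τ / 2) • (y - α) ∈ F := hF.convex.add_smul_sub_mem hα hyF
      ⟨by positivity, by have : τ ≤ 2 := min_le_right _ _; linarith⟩
    have h4 : α + τ • v ∈ F := by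
      refine hF.isExtreme.left_mem_of_mem_openSegment h1 h2 h3
        ⟨1 / 2, 1 / 2, by norm_num, by norm_num, by norm_num, ?_⟩
      rw [hw]
      module
    rw [hv, smul_smul] at h4
    exact hi (mem_faceDirections.2 ⟨_, by positivity, h4⟩)
  · intro h
    have key : ∀ s : Finset ι, ∃ ε : ℝ, 0 < ε ∧
        α + ε • (∑ i ∈ s, b.repr (y - α) i • b i) ∈ F := by
      intro s
      induction s using Finset.induction_on with
      | empty => exact ⟨1, one_pos, by simpa using hα⟩
      | insert i s hi ih =>
        rw [Finset.sum_insert hi]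
        refine exists_pos_add_smul_add_mem hF.convex hα ?_ ih
        by_cases hz : b.repr (y - α) i = 0
        · exact ⟨1, one_pos, by rw [hz, zero_smul, smul_zero, add_zero]; exact hα⟩
        have hpos : 0 < b.repr (y - α) i := lt_of_le_of_ne (hb.repr_nonneg hy i) (Ne.symm hz)
        obtain ⟨ε, hε, hm⟩ := mem_faceDirections.1 (not_imp_comm.1 (h i) hz)
        refine ⟨ε / b.repr (y - α) i, by positivity, ?_⟩
        rwa [smul_smul, div_mul_cancel₀ _ hz]
    obtain ⟨ε, hε, hm⟩ := key Finset.univ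
    rw [b.sum_repr] at hm
    -- The cap 1/2 makes the point of `F` interior to the segment from `α` to `y`, so extremality
    -- applies.
    have hm' := add_smul_mem_of_le hF.convex hα hm (δ := min ε (1 / 2)) (by positivity)
      (min_le_left _ _)
    refine hF.isExtreme.left_mem_of_mem_openSegment hy hαP hm'
      ⟨min ε (1 / 2), 1 - min ε (1 / 2), by positivity, ?_, by ring, by module⟩
    have : min ε (1 / 2) ≤ 1 / 2 := min_le_right _ _
    linarith

theorem IsFace.self {P : Set E} (hP : Convex ℝ P) (hc : IsClosed P) (hne : P.Nonempty) :
    IsFace P P :=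
  ⟨IsExtreme.rfl, hP, hc, hne⟩

theorem dual_eq_sum_repr (b : Module.Basis ι ℝ E) (ζ : Module.Dual ℝ E) (v : E) :
    ζ v = ∑ i, b.repr v i * ζ (b i) := by
  conv_lhs => rw [← b.sum_repr v]
  simp only [map_sum, map_smul, smul_eq_mul]

/-- The maximisers of `ζ` on `F` form a compact exposed face, which has an extreme point;
extremality is transitive. -/
theorem IsFace.exists_vertex [FiniteDimensional ℝ E] {P F : Set E} (hPc : IsCompact P)
    (hF : IsFace P F) (ζ : Module.Dual ℝ E) :
    ∃ α ∈ P.extremePoints ℝ, α ∈ F ∧ ∀ y ∈ F, ζ y ≤ ζ α := by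
  have hFc : IsCompact F := hPc.of_isClosed_subset hF.isClosed hF.isExtreme.subset
  have hcont : Continuous ζ := ζ.continuous_of_finiteDimensional
  obtain ⟨m, hm, hmax⟩ := hFc.exists_isMaxOn hF.nonempty hcont.continuousOn
  have hG : IsExposed ℝ F {x ∈ F | ∀ y ∈ F, ζ y ≤ ζ x} := by
    intro _
    exact ⟨LinearMap.toContinuousLinearMap ζ, rfl⟩
  obtain ⟨α, hα⟩ := (hG.isCompact hFc).extremePoints_nonempty ⟨m, hm, hmax⟩
  exact ⟨α, (hF.isExtreme.trans hG.isExtreme).extremePoints_subset_extremePoints hα, hα.1.1, hα.1.2⟩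

theorem IsFace.exists_vertex_neg [FiniteDimensional ℝ E] {P F : Set E} (hPc : IsCompact P)
    (hF : IsFace P F) {b : E → Module.Basis ι ℝ E} {ζ : Module.Dual ℝ E}
    (hζ : ∀ α ∈ P.extremePoints ℝ, ∀ i, ζ (b α i) ≠ 0) :
    ∃ α ∈ P.extremePoints ℝ, α ∈ F ∧ ∀ i ∈ faceDirections (b α) α F, ζ (b α i) < 0 := by
  obtain ⟨α, hα, hαF, hmax⟩ := hF.exists_vertex hPc ζ
  refine ⟨α, hα, hαF, fun i hi => lt_of_le_of_ne ?_ (hζ α hα i)⟩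
  obtain ⟨ε, hε, hm⟩ := mem_faceDirections.1 hi
  have := hmax _ hm
  simp only [map_add, map_smul, smul_eq_mul] at this
  by_contra! hcon
  nlinarith [mul_pos hε hcon]

/-- `F - α` consists of nonnegative combinations of the face directions, so a strict decrease along
these makes `α` the unique global maximum. -/
theorem IsFace.le_of_neg {P F : Set E} (hP : Convex ℝ P) (hF : IsFace P F) {α : E} (hα : α ∈ F)
    {b : Module.Basis ι ℝ E} (hb : IsConeBasis P α b) {ζ : Module.Dual ℝ E}
    (hneg : ∀ i ∈ faceDirections b α F, ζ (b i) < 0) {y : E} (hy : y ∈ F) :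
    ζ y ≤ ζ α ∧ (ζ y = ζ α → y = α) := by
  have hyP := hF.isExtreme.subset hy
  have h0 := (hF.mem_iff hP hα hb hyP).1 hy
  have hterm : ∀ i ∈ Finset.univ, b.repr (y - α) i * ζ (b i) ≤ 0 := by
    intro i _
    by_cases hi : i ∈ faceDirections b α F
    · exact mul_nonpos_of_nonneg_of_nonpos (hb.repr_nonneg hyP i) (hneg i hi).le
    · rw [h0 i hi, zero_mul]
  have hsum : ζ y - ζ α = ∑ i, b.repr (y - α) i * ζ (b i) := by
    rw [← map_sub, dual_eq_sum_repr b]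
  refine ⟨by linarith [Finset.sum_nonpos hterm], fun heq => ?_⟩
  rw [heq, sub_self, eq_comm, Finset.sum_eq_zero_iff_of_nonpos hterm] at hsum
  rw [← sub_eq_zero]
  refine b.ext_elem fun i => ?_
  by_cases hi : i ∈ faceDirections b α F
  · simpa [(hneg i hi).ne] using hsum i (Finset.mem_univ i)
  · simpa using h0 i hi

theorem IsFace.vertex_unique {P F : Set E} (hP : Convex ℝ P) (hF : IsFace P F) {α β : E}
    (hα : α ∈ F) (hβ : β ∈ F) {b c : Module.Basis ι ℝ E} (hb : IsConeBasis P α b)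
    (hc : IsConeBasis P β c) {ζ : Module.Dual ℝ E}
    (hnegα : ∀ i ∈ faceDirections b α F, ζ (b i) < 0)
    (hnegβ : ∀ i ∈ faceDirections c β F, ζ (c i) < 0) : α = β := by
  have h1 := hF.le_of_neg hP hα hb hnegα hβ
  have h2 := hF.le_of_neg hP hβ hc hnegβ hα
  exact h2.2 (le_antisymm h2.1 h1.1)

/-- With `IsFace.eq_faceAt`: faces through `α` correspond to arbitrary subsets of the edge
directions. This is where simplicity enters. -/
theorem faceDirections_faceAt {P : Set E} (hP : Convex ℝ P) {α : E} (hα : α ∈ P)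
    {b : Module.Basis ι ℝ E} (hb : IsConeBasis P α b) (J : Finset ι) :
    faceDirections b α (faceAt P α b J) = J := by
  classical
  ext i
  rw [mem_faceDirections]
  constructor
  · rintro ⟨ε, hε, -, h⟩
    by_contra hi
    have := h i hi
    simp [hε.ne'] at this
  · intro hi
    have : b i ∈ tangentCone P α := by
      rw [hb]; intro j
      rw [b.repr_self, Finsupp.single_apply]
      split_ifs <;> norm_num
    obtain ⟨ε, hε, hm⟩ := exists_pos_add_smul_mem hP hα this
    refine ⟨ε, hε, hm, fun j hj => ?_⟩
    have hij : i ≠ j := fun h => hj (h ▸ hi)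
    simp [hij]

theorem IsFace.eq_faceAt {P F : Set E} (hP : Convex ℝ P) (hF : IsFace P F) {α : E} (hα : α ∈ F)
    {b : Module.Basis ι ℝ E} (hb : IsConeBasis P α b) :
    faceAt P α b (faceDirections b α F) = F := by
  ext y
  constructor
  · rintro ⟨hy, h⟩
    exact (hF.mem_iff hP hα hb hy).2 h
  · intro hy
    exact ⟨hF.isExtreme.subset hy, (hF.mem_iff hP hα hb (hF.isExtreme.subset hy)).1 hy⟩

/-- Shows that the sign `(-1) ^ #J` depends on the face only, not on the vertex from which it is
seen. -/
theorem IsFace.finrank_vectorSpan {P F : Set E} (hP : Convex ℝ P) (hF : IsFace P F) {α : E}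
    (hα : α ∈ F) {b : Module.Basis ι ℝ E} (hb : IsConeBasis P α b) :
    Module.finrank ℝ (vectorSpan ℝ F) = (faceDirections b α F).card := by
  classical
  have : vectorSpan ℝ F = Submodule.span ℝ (Set.range fun i : faceDirections b α F => b i) := by
    rw [vectorSpan_eq_span_vsub_set_right ℝ hα]
    apply le_antisymm
    · rw [Submodule.span_le]
      rintro _ ⟨y, hy, rfl⟩
      have h0 := (hF.mem_iff hP hα hb (hF.isExtreme.subset hy)).1 hy
      simp only [vsub_eq_sub, SetLike.mem_coe]
      rw [← b.sum_repr (y - α)]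
      refine Submodule.sum_mem _ fun i _ => ?_
      by_cases hi : i ∈ faceDirections b α F
      · exact Submodule.smul_mem _ _ (Submodule.subset_span ⟨⟨i, hi⟩, rfl⟩)
      · rw [h0 i hi, zero_smul]; exact Submodule.zero_mem _
    · rw [Submodule.span_le]
      rintro _ ⟨⟨i, hi⟩, rfl⟩
      obtain ⟨ε, hε, hm⟩ := mem_faceDirections.1 hi
      have : b i = ε⁻¹ • ((α + ε • b i) -ᵥ α) := by
        simp [smul_smul, hε.ne']
      simp only [SetLike.mem_coe]
      rw [this]
      exact Submodule.smul_mem _ _ (Submodule.subset_span ⟨_, hm, rfl⟩)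
  rw [this, finrank_span_eq_card, Fintype.card_coe]
  exact b.linearIndependent.comp _ Subtype.val_injective

/-- Some point of `F` can be moved towards `x` within `P`. -/
def IsInwardFace (P : Set E) (x : E) (F : Set E) : Prop :=
  ∃ p ∈ F, ∃ ε : ℝ, 0 < ε ∧ ε < 1 ∧ p + ε • (x - p) ∈ P

/-- Coordinates transverse to `F` vanish on `F`, so a step towards `x` must not decrease them;
negative coordinates along `F` are absorbed by starting from a point displaced in all face
directions. The local condition on `x` is thus independent of the vertex. -/
theorem IsFace.isInwardFace_iff {P F : Set E} (hP : Convex ℝ P) (hF : IsFace P F) {α : E}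
    (hα : α ∈ F) {b : Module.Basis ι ℝ E} (hb : IsConeBasis P α b) (x : E) :
    IsInwardFace P x F ↔ ∀ i ∉ faceDirections b α F, 0 ≤ b.repr (x - α) i := by
  classical
  have hαP := hF.isExtreme.subset hα
  constructor
  · rintro ⟨p, hp, ε, hε, hε1, hm⟩ i hi
    have h0 := (hF.mem_iff hP hα hb (hF.isExtreme.subset hp)).1 hp i hi
    have h1 := hb.repr_nonneg hm i
    rw [show p + ε • (x - p) - α = (1 - ε) • (p - α) + ε • (x - α) by module] at h1
    simp only [map_add, map_smul, Finsupp.add_apply, Finsupp.smul_apply, smul_eq_mul, h0, mul_zero,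
      zero_add] at h1
    exact nonneg_of_mul_nonneg_right h1 hε
  · intro h
    have key : ∀ s ⊆ faceDirections b α F, ∃ ε : ℝ, 0 < ε ∧
        α + ε • (∑ i ∈ s, b i) ∈ F := by
      intro s
      induction s using Finset.induction_on with
      | empty => exact fun _ => ⟨1, one_pos, by simpa using hα⟩
      | insert i s hi ih =>
        intro hs
        rw [Finset.sum_insert hi]
        exact exists_pos_add_smul_add_mem hF.convex hα
          (mem_faceDirections.1 (hs (Finset.mem_insert_self _ _)))
          (ih ((Finset.subset_insert _ _).trans hs))
    obtain ⟨δ, hδ, hp⟩ := key _ subset_rfl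
    set u := ∑ i ∈ faceDirections b α F, b i with hu
    have hur : ∀ i, b.repr u i = if i ∈ faceDirections b α F then 1 else 0 := by
      intro i
      simp [hu, Finsupp.single_apply]
    -- a combination of `u` and `x - α` with nonnegative coordinates
    obtain ⟨M, hM0, hM⟩ : ∃ M : ℝ, 0 < M ∧ ∀ i, 0 ≤ M + b.repr (x - α) i := by
      refine ⟨1 + ∑ i, |b.repr (x - α) i|, by positivity, fun i => ?_⟩
      have := Finset.single_le_sum (f := fun i => |b.repr (x - α) i|)
        (fun _ _ => abs_nonneg _) (Finset.mem_univ i)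
      have := neg_abs_le (b.repr (x - α) i)
      linarith
    have hC : M • u + (x - α) ∈ tangentCone P α := by
      rw [hb]; intro i
      simp only [map_add, map_smul, Finsupp.add_apply, Finsupp.smul_apply, smul_eq_mul, hur]
      split_ifs with hi
      · simpa using hM i
      · simpa using h i hi
    obtain ⟨ε, hε, hm⟩ := exists_pos_add_smul_mem hP hαP hC
    -- choose the step `τ` with `(1 - τ) * p = τ * M` for a small `p`
    set τ := min (min ε (1 / 2)) (δ / (2 * M)) with hτ
    have hτ0 : 0 < τ := by positivity
    have hτ1 : τ ≤ 1 / 2 := (min_le_left _ _).trans (min_le_right _ _)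
    have hτε : τ ≤ ε := (min_le_left _ _).trans (min_le_left _ _)
    have hτδ : τ * M / (1 - τ) ≤ δ := by
      rw [div_le_iff₀ (by linarith)]
      have : τ * (2 * M) ≤ δ := (le_div_iff₀ (by positivity)).1 (min_le_right _ _)
      nlinarith
    refine ⟨α + (τ * M / (1 - τ)) • u, add_smul_mem_of_le hF.convex hα hp
      (div_nonneg (by positivity) (by linarith)) hτδ, τ, hτ0, by linarith, ?_⟩
    have := add_smul_mem_of_le hP hαP hm hτ0.le hτε
    convert this using 1
    have h1 : (1 - τ) ≠ 0 := by linarith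
    have h2 : (τ * M / (1 - τ)) • u - τ • (τ * M / (1 - τ)) • u = (τ * M) • u := by
      rw [smul_smul, ← sub_smul]; congr 1; field_simp
    calc _ = α + ((τ * M / (1 - τ)) • u - τ • (τ * M / (1 - τ)) • u) + τ • (x - α) := by module
      _ = _ := by rw [h2]; module

end

/-! ### Signed decomposition into flipped cones -/

section

open Finset in
-- Inclusion-exclusion for the condition `A = N`; with `A`, `N` the negative sets of `x - α` and of
-- `ζ`, this condition is membership in `flippedCone`.
theorem sum_Icc_neg_one_pow_card {ι : Type*} [DecidableEq ι] (A N : Finset ι) :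
    ∑ J ∈ Icc A N, (-1 : ℝ) ^ #J = if A = N then (-1) ^ #N else 0 := by
  by_cases h : A ⊆ N
  · rw [Icc_eq_image_powerset h, sum_image]
    · have h1 : ∀ J ∈ (N \ A).powerset, (-1 : ℝ) ^ #(A ∪ J) = (-1) ^ #A * ((-1 : ℤ) ^ #J : ℤ) := by
        intro J hJ
        rw [card_union_of_disjoint, pow_add]
        · push_cast; rfl
        · exact disjoint_of_subset_right (mem_powerset.1 hJ) disjoint_sdiff
      rw [sum_congr rfl h1, ← mul_sum, ← Int.cast_sum, sum_powerset_neg_one_pow_card]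
      by_cases hAN : A = N
      · simp [hAN]
      · have : N \ A ≠ ∅ := fun h' => hAN (h.antisymm (sdiff_eq_empty_iff_subset.1 h'))
        simp [hAN, this]
    · intro J hJ K hK hJK
      have hJ' := disjoint_of_subset_right (mem_powerset.1 hJ) (disjoint_sdiff (s := A))
      have hK' := disjoint_of_subset_right (mem_powerset.1 hK) (disjoint_sdiff (s := A))
      rw [← union_sdiff_cancel_left hJ', ← union_sdiff_cancel_left hK']
      exact congrArg (· \ A) hJK
  · rw [Icc_eq_empty h, sum_empty, if_neg fun h' => h h'.subset]

variable {E : Type*} [NormedAddCommGroup E] [NormedSpace ℝ E] {ι : Type*} [Fintype ι]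

/-- The half-open cone at `α` obtained from the cone on `b` by reversing the generators on which
`ζ` is negative. -/
def flippedCone (α : E) (b : Module.Basis ι ℝ E) (ζ : Module.Dual ℝ E) : Set E :=
  {x | ∀ i, b.repr (x - α) i < 0 ↔ ζ (b i) < 0}

open Filter Topology in
-- A separating form is perturbed by a small multiple of a form vanishing on no basis vector; only
-- finitely many open conditions must survive.
theorem exists_generic_dual_lt {P : Set E} (hPc : IsCompact P) (hP : Convex ℝ P)
    (hfin : (P.extremePoints ℝ).Finite) (b : E → Module.Basis ι ℝ E) {x : E} (hx : x ∉ P) :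
    ∃ η : Module.Dual ℝ E, (∀ α ∈ P.extremePoints ℝ, ∀ i, η (b α i) ≠ 0) ∧
      ∀ α ∈ P.extremePoints ℝ, η (x - α) < 0 := by
  obtain ⟨f, u, hfx, hf⟩ := geometric_hahn_banach_point_closed hP hPc.isClosed hx
  have := hfin.to_subtype
  obtain ⟨g, hg⟩ := Module.exists_dual_forall_apply_ne_zero (K := ℝ)
    (fun p : P.extremePoints ℝ × ι => b p.1 p.2) fun p => (b p.1).ne_zero p.2
  have hlim : ∀ v : E, Tendsto (fun ε : ℝ => f v + ε * g v) (𝓝[≠] 0) (𝓝 (f v)) := by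
    intro v
    have : Continuous fun ε : ℝ => f v + ε * g v := by fun_prop
    simpa using (this.tendsto 0).mono_left nhdsWithin_le_nhds
  have h1 : ∀ᶠ ε : ℝ in 𝓝[≠] 0, ∀ p : P.extremePoints ℝ × ι,
      f (b p.1 p.2) + ε * g (b p.1 p.2) ≠ 0 := by
    refine eventually_all.2 fun p => ?_
    by_cases h0 : f (b p.1 p.2) = 0
    · filter_upwards [self_mem_nhdsWithin] with ε hε
      simpa [h0] using ⟨hε, hg p⟩
    · exact (hlim _).eventually_ne h0
  have h2 : ∀ᶠ ε : ℝ in 𝓝[≠] 0, ∀ α : P.extremePoints ℝ,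
      f (x - α) + ε * g (x - α) < 0 := by
    refine eventually_all.2 fun α => (hlim _).eventually_lt_const ?_
    have := hf α α.2.1
    rw [map_sub]
    linarith
  obtain ⟨ε, h1, h2⟩ := (h1.and h2).exists
  exact ⟨(f : E →ₗ[ℝ] ℝ) + ε • g, fun α hα i => h1 (⟨α, hα⟩, i), fun α hα => h2 ⟨α, hα⟩⟩

variable [FiniteDimensional ℝ E] [DecidableEq ι]

open Finset in
/-- Each face is counted at its vertex of largest value of `ζ`. -/
theorem sum_vertices_eq_finsum_faces {P : Set E} (hPc : IsCompact P) (hP : Convex ℝ P)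
    (hfin : (P.extremePoints ℝ).Finite) {b : E → Module.Basis ι ℝ E}
    (hb : ∀ α ∈ P.extremePoints ℝ, IsConeBasis P α (b α)) {ζ : Module.Dual ℝ E}
    (hζ : ∀ α ∈ P.extremePoints ℝ, ∀ i, ζ (b α i) ≠ 0) (x : E) :
    ∑ α ∈ hfin.toFinset, ∑ J ∈ Icc ({i | (b α).repr (x - α) i < 0} : Finset ι)
      ({i | ζ (b α i) < 0} : Finset ι), (-1 : ℝ) ^ #J =
      ∑ᶠ F ∈ {F | IsFace P F ∧ IsInwardFace P x F}, (-1) ^ Module.finrank ℝ (vectorSpan ℝ F) := by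
  rw [sum_sigma', ← finsum_mem_coe_finset]
  have hmem : ∀ p : (_ : E) × Finset ι, p ∈ (hfin.toFinset.sigma fun α =>
      Icc ({i | (b α).repr (x - α) i < 0} : Finset ι) ({i | ζ (b α i) < 0} : Finset ι)) ↔
      p.1 ∈ P.extremePoints ℝ ∧ (∀ i ∉ p.2, 0 ≤ (b p.1).repr (x - p.1) i) ∧
        ∀ i ∈ p.2, ζ (b p.1 i) < 0 := by
    rintro ⟨α, J⟩
    simp only [mem_sigma, Set.Finite.mem_toFinset, mem_Icc, 
      Finset.subset_iff, mem_filter_univ]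
    refine and_congr_right fun _ => and_congr_left fun _ => forall_congr' fun i => ?_
    rw [← not_lt, not_imp_not]
  -- Injectivity is uniqueness of the `ζ`-maximal vertex of a face; surjectivity is its existence.
  refine finsum_mem_eq_of_bijOn (fun p => faceAt P p.1 (b p.1) p.2) ⟨?_, ?_, ?_⟩ ?_
  · intro p hp
    obtain ⟨hα, hx, hn⟩ := (hmem p).1 hp
    have hF := isFace_faceAt hP hPc.isClosed hα.1 (hb _ hα) p.2
    refine ⟨hF, ?_⟩
    rw [hF.isInwardFace_iff hP (mem_faceAt_self hα.1 _ _) (hb _ hα),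
      faceDirections_faceAt hP hα.1 (hb _ hα)]
    exact hx
  · rintro ⟨α, J⟩ hp ⟨β, K⟩ hq hpq
    obtain ⟨hα, -, hn⟩ := (hmem _).1 hp
    obtain ⟨hβ, -, hm⟩ := (hmem _).1 hq
    simp only at hpq hα hβ hn hm
    have hF := isFace_faceAt hP hPc.isClosed hα.1 (hb _ hα) J
    have h1 := faceDirections_faceAt hP hα.1 (hb _ hα) J
    have h2 := faceDirections_faceAt hP hβ.1 (hb _ hβ) K
    rw [← hpq] at h2
    have : α = β := hF.vertex_unique hP (mem_faceAt_self hα.1 _ _)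
      (hpq ▸ mem_faceAt_self hβ.1 _ _) (hb _ hα) (hb _ hβ) (h1.symm ▸ hn) (h2.symm ▸ hm)
    subst this
    rw [h1] at h2
    rw [h2]
  · rintro F ⟨hF, hx⟩
    obtain ⟨α, hα, hαF, hn⟩ := hF.exists_vertex_neg hPc hζ
    refine ⟨⟨α, faceDirections (b α) α F⟩, (hmem _).2 ⟨hα, ?_, hn⟩,
      hF.eq_faceAt hP hαF (hb _ hα)⟩
    exact (hF.isInwardFace_iff hP hαF (hb _ hα) x).1 hx
  · intro p hp
    obtain ⟨hα, -, -⟩ := (hmem p).1 hp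
    rw [(isFace_faceAt hP hPc.isClosed hα.1 (hb _ hα) p.2).finrank_vectorSpan hP
      (mem_faceAt_self hα.1 _ _) (hb _ hα), faceDirections_faceAt hP hα.1 (hb _ hα)]

open Finset in
theorem sum_flippedCone_eq_finsum_faces {P : Set E} (hPc : IsCompact P) (hP : Convex ℝ P)
    (hfin : (P.extremePoints ℝ).Finite) {b : E → Module.Basis ι ℝ E}
    (hb : ∀ α ∈ P.extremePoints ℝ, IsConeBasis P α (b α)) {ζ : Module.Dual ℝ E}
    (hζ : ∀ α ∈ P.extremePoints ℝ, ∀ i, ζ (b α i) ≠ 0) (x : E) :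
    ∑ α ∈ hfin.toFinset, (flippedCone α (b α) ζ).indicator
      (fun _ => (-1 : ℝ) ^ #{i | ζ (b α i) < 0}) x =
      ∑ᶠ F ∈ {F | IsFace P F ∧ IsInwardFace P x F}, (-1) ^ Module.finrank ℝ (vectorSpan ℝ F) := by
  classical
  rw [← sum_vertices_eq_finsum_faces hPc hP hfin hb hζ x]
  refine sum_congr rfl fun α _ => ?_
  rw [sum_Icc_neg_one_pow_card, Set.indicator_apply]
  refine if_congr ?_ rfl rfl
  simp [flippedCone, Finset.ext_iff]

open Finset in
/-- A simple polytope is the signed sum of its flipped vertex cones. -/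
theorem sum_indicator_flippedCone {P : Set E} (hPc : IsCompact P) (hP : Convex ℝ P)
    (hfin : (P.extremePoints ℝ).Finite) {b : E → Module.Basis ι ℝ E}
    (hb : ∀ α ∈ P.extremePoints ℝ, IsConeBasis P α (b α)) {ζ : Module.Dual ℝ E}
    (hζ : ∀ α ∈ P.extremePoints ℝ, ∀ i, ζ (b α i) ≠ 0) (x : E) :
    ∑ α ∈ hfin.toFinset, (flippedCone α (b α) ζ).indicator
      (fun _ => (-1 : ℝ) ^ #{i | ζ (b α i) < 0}) x = P.indicator 1 x := by
  by_cases hx : x ∈ P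
  · have hF := IsFace.self hP hPc.isClosed ⟨x, hx⟩
    have hdir : ∀ α ∈ P.extremePoints ℝ, faceDirections (b α) α P = univ := by
      intro α hα
      convert faceDirections_faceAt hP hα.1 (hb α hα) univ using 2
      simp [faceAt]
    -- Maximising `-ζ` finds the `ζ`-minimal vertex, where no generator is reversed.
    have hζ' : ∀ α ∈ P.extremePoints ℝ, ∀ i, (-ζ) (b α i) ≠ 0 := by simpa using hζ
    obtain ⟨α, hα, hαP, hneg⟩ := hF.exists_vertex_neg hPc hζ'
    have hpos : ∀ i, 0 < ζ (b α i) := by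
      intro i
      simpa using hneg i (by rw [hdir α hα]; exact mem_univ i)
    rw [sum_eq_single_of_mem α (hfin.mem_toFinset.2 hα)]
    · have h1 : x ∈ flippedCone α (b α) ζ := fun i =>
        ⟨fun h => absurd h ((hb α hα).repr_nonneg hx i).not_gt, fun h => absurd h (hpos i).not_gt⟩
      have h2 : ({i | ζ (b α i) < 0} : Finset ι) = ∅ := by
        simpa [filter_eq_empty_iff] using fun i => (hpos i).le
      simp [h1, h2, hx]
    · intro β hβ hne
      -- A flipped cone at `β` containing a point of `P` has no reversed generator, so `β` is also
      -- `ζ`-minimal.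
      rw [hfin.mem_toFinset] at hβ
      refine Set.indicator_of_notMem (fun hxβ => hne ?_) _
      refine hF.vertex_unique hP hβ.1 hαP (hb β hβ) (hb α hα) (ζ := -ζ) (fun i _ => ?_) hneg
      have h3 : ¬ ζ (b β i) < 0 := fun h =>
        ((hb β hβ).repr_nonneg hx i).not_gt ((hxβ i).2 h)
      have h4 := lt_of_le_of_ne (not_lt.1 h3) (hζ β hβ i).symm
      simpa using h4
  · obtain ⟨η, hη, hlt⟩ := exists_generic_dual_lt hPc hP hfin b hx
    rw [sum_flippedCone_eq_finsum_faces hPc hP hfin hb hζ,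
      ← sum_flippedCone_eq_finsum_faces hPc hP hfin hb hη, Set.indicator_of_notMem hx]
    refine sum_eq_zero fun α hα => Set.indicator_of_notMem (fun hxα => ?_) _
    refine (hlt α (hfin.mem_toFinset.1 hα)).not_ge ?_
    rw [dual_eq_sum_repr (b α)]
    refine sum_nonneg fun i _ => ?_
    by_cases h : η (b α i) < 0
    · exact mul_nonneg_of_nonpos_of_nonpos ((hxα i).2 h).le h.le
    · exact mul_nonneg (not_lt.1 fun h' => h ((hxα i).1 h')) (not_lt.1 h)

end

/-! ### Volumes of simplices and truncated cones -/

section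

open Set in
theorem volume_simplex (n : ℕ) {r : ℝ} (hr : 0 ≤ r) :
    volume {y : Fin n → ℝ | (∀ i, 0 ≤ y i) ∧ ∑ i, y i ≤ r} =
      ENNReal.ofReal (r ^ n / n.factorial) := by
  induction n generalizing r with
  | zero => simp [hr, volume_pi]
  | succ n ih =>
    set T : Set (ℝ × (Fin n → ℝ)) := {p | 0 ≤ p.1 ∧ (∀ i, 0 ≤ p.2 i) ∧ p.1 + ∑ i, p.2 i ≤ r}
    have hT : MeasurableSet T := by
      have h1 : IsClosed {p : ℝ × (Fin n → ℝ) | 0 ≤ p.1} :=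
        isClosed_le (by fun_prop) (by fun_prop)
      have h2 : IsClosed {p : ℝ × (Fin n → ℝ) | ∀ i, 0 ≤ p.2 i} := by
        simp only [Set.ofPred_forall]
        exact isClosed_iInter fun i => isClosed_le (by fun_prop) (by fun_prop)
      have h3 : IsClosed {p : ℝ × (Fin n → ℝ) | p.1 + ∑ i, p.2 i ≤ r} :=
        isClosed_le (by fun_prop) (by fun_prop)
      exact (h1.inter (h2.inter h3)).measurableSet
    have hpre : {y : Fin (n + 1) → ℝ | (∀ i, 0 ≤ y i) ∧ ∑ i, y i ≤ r} =
        MeasurableEquiv.piFinSuccAbove (fun _ => ℝ) 0 ⁻¹' T := by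
      ext y
      simp [T, Fin.forall_fin_succ, Fin.sum_univ_succ, and_assoc, Fin.tail]
    rw [hpre, (volume_preserving_piFinSuccAbove (fun _ => ℝ) 0).measure_preimage
      hT.nullMeasurableSet, Measure.volume_eq_prod, Measure.prod_apply hT]
    have hsec : ∀ t : ℝ, volume (Prod.mk t ⁻¹' T) =
        (Icc 0 r).indicator (fun t => ENNReal.ofReal ((r - t) ^ n / n.factorial)) t := by
      intro t
      by_cases ht : t ∈ Icc 0 r
      · rw [indicator_of_mem ht, ← ih (sub_nonneg.2 ht.2)]
        congr 1
        ext y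
        simp [T, ht.1, le_sub_iff_add_le']
      · rw [indicator_of_notMem ht]
        convert measure_empty (μ := (volume : Measure (Fin n → ℝ)))
        ext y
        simp only [T, mem_preimage, mem_ofPred_eq, mem_empty_iff_false, iff_false]
        rintro ⟨h1, h2, h3⟩
        exact ht ⟨h1, by linarith [Finset.sum_nonneg fun i (_ : i ∈ Finset.univ) => h2 i]⟩
    rw [lintegral_congr hsec, lintegral_indicator measurableSet_Icc,
      ← ofReal_integral_eq_lintegral_ofReal]
    · rw [integral_Icc_eq_integral_Ioc, ← intervalIntegral.integral_of_le hr,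
        intervalIntegral.integral_div, intervalIntegral.integral_comp_sub_left (fun x => x ^ n) r]
      congr 1
      simp only [sub_self, sub_zero, integral_pow, Nat.factorial_succ]
      push_cast
      field_simp
      simp
    · exact (Continuous.integrableOn_Icc (by fun_prop))
    · filter_upwards [ae_restrict_mem measurableSet_Icc] with t ht
      have := sub_nonneg.2 ht.2
      positivity

variable {E : Type*} [NormedAddCommGroup E] [NormedSpace ℝ E]
  [MeasurableSpace E] [BorelSpace E] {ι : Type*} [Fintype ι]

open Set in
-- In coordinates `μ` is a multiple of Lebesgue measure; the unit cube gives the constant.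
theorem measure_preimage_equivFun (μ : Measure E) [μ.IsAddHaarMeasure]
    (b : Module.Basis ι ℝ E) {S : Set (ι → ℝ)} (hS : MeasurableSet S) :
    μ (b.equivFun ⁻¹' S) = μ (ZSpan.fundamentalDomain b) * volume S := by
  set ν := μ.map b.equivFunL with hν
  have : ν.IsAddHaarMeasure := b.equivFunL.isAddHaarMeasure_map μ
  have hmeas : Measurable b.equivFunL := b.equivFunL.continuous.measurable
  have hscal := Measure.isAddLeftInvariant_eq_smul ν volume
  have hap : ∀ T, MeasurableSet T → μ (b.equivFun ⁻¹' T) = ν T := fun T hT => by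
    rw [hν, Measure.map_apply hmeas hT]; rfl
  have hcube : MeasurableSet (Set.pi univ fun _ : ι => Ico (0 : ℝ) 1) :=
    MeasurableSet.univ_pi fun _ => measurableSet_Ico
  have h1 : ZSpan.fundamentalDomain b = b.equivFun ⁻¹' (Set.pi univ fun _ => Ico 0 1) := by
    ext x; simp [ZSpan.mem_fundamentalDomain, Set.mem_pi]
  rw [h1, hap _ hS, hap _ hcube, hscal]
  simp [volume_pi_pi]

open Set in
theorem measure_flippedCone_inter [FiniteDimensional ℝ E] {n : ℕ} (μ : Measure E)
    [μ.IsAddHaarMeasure] (b : Module.Basis (Fin n) ℝ E) {ζ : Module.Dual ℝ E} (hζ : ∀ i, ζ (b i) ≠ 0) (α : E) {c : ℝ}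
    (hc : ζ α ≤ c) :
    μ (flippedCone α b ζ ∩ {x | ζ x ≤ c}) = ENNReal.ofReal
      (μ.real (ZSpan.fundamentalDomain b) * (c - ζ α) ^ n / (n.factorial * |∏ i, ζ (b i)|)) := by
  -- Dividing by `ζ (b i)` performs the flip and makes `ζ - ζ α` the sum of the coordinates, so the
  -- truncated cone becomes a standard simplex, up to null boundary faces.
  set b' := b.isUnitSMul (w := fun i => (ζ (b i))⁻¹) fun i => (inv_ne_zero (hζ i)).isUnit with hb'
  have hrepr : ∀ v i, b'.equivFun v i = b.repr v i * ζ (b i) := by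
    intro v i
    have : v = ∑ i, (b.repr v i * ζ (b i)) • b' i := by
      conv_lhs => rw [← b.sum_repr v]
      refine Finset.sum_congr rfl fun i _ => ?_
      rw [hb', b.isUnitSMul_apply, smul_smul, mul_assoc, mul_inv_cancel₀ (hζ i), mul_one]
    conv_lhs => rw [this]
    rw [← b'.equivFun_symm_apply, LinearEquiv.apply_symm_apply]
  set I : Fin n → Set ℝ := fun i => if ζ (b i) < 0 then Ioi 0 else Ici 0 with hI
  set S : Set (Fin n → ℝ) := Set.pi univ I ∩ {y | ∑ i, y i ≤ c - ζ α} with hS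
  have hSm : MeasurableSet S := by
    refine (MeasurableSet.univ_pi fun i => ?_).inter
      (measurableSet_le (by fun_prop) (by fun_prop))
    simp only [hI]
    split_ifs
    exacts [measurableSet_Ioi, measurableSet_Ici]
  have hpre : flippedCone α b ζ ∩ {x | ζ x ≤ c} =
      (fun x => x + -α) ⁻¹' (b'.equivFun ⁻¹' S) := by
    ext x
    simp only [flippedCone, hS, mem_inter_iff, mem_ofPred_eq, mem_preimage, mem_univ_pi, hrepr,
      ← sub_eq_add_neg]
    refine and_congr (forall_congr' fun i => ?_) ?_
    · simp only [hI]
      split_ifs with h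
      · simp only [h, iff_true, mem_Ioi]
        exact ⟨fun h' => mul_pos_of_neg_of_neg h' h, fun h' => neg_of_mul_pos_left h' h.le⟩
      · have hp : 0 < ζ (b i) := lt_of_le_of_ne (not_lt.1 h) (hζ i).symm
        simp only [h, iff_false, mem_Ici, not_lt]
        exact (mul_nonneg_iff_of_pos_right hp).symm
    · rw [← dual_eq_sum_repr b, map_sub]
      exact (sub_le_sub_iff_right _).symm
  have hvol : volume S = ENNReal.ofReal ((c - ζ α) ^ n / n.factorial) := by
    rw [← volume_simplex n (sub_nonneg.2 hc)]
    refine measure_congr ?_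
    have : {y : Fin n → ℝ | (∀ i, 0 ≤ y i) ∧ ∑ i, y i ≤ c - ζ α} =
        (Set.pi univ fun _ => Ici 0) ∩ {y | ∑ i, y i ≤ c - ζ α} := by
      ext y; simp only [mem_ofPred_eq, mem_inter_iff, mem_univ_pi, mem_Ici]
    rw [this]
    refine Filter.EventuallyEq.inter (Measure.ae_eq_set_pi fun i _ => ?_) Filter.EventuallyEq.rfl
    simp only [hI]
    split_ifs
    exacts [Ioi_ae_eq_Ici, Filter.EventuallyEq.rfl]
  have hfd : μ (ZSpan.fundamentalDomain b') =
      ENNReal.ofReal (|∏ i, ζ (b i)|⁻¹ * μ.real (ZSpan.fundamentalDomain b)) := by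
    have hfin : μ (ZSpan.fundamentalDomain b) ≠ ⊤ :=
      (ZSpan.fundamentalDomain_isBounded b).measure_lt_top.ne
    rw [ZSpan.measure_fundamentalDomain b' μ b, ENNReal.ofReal_mul (by positivity),
      ofReal_measureReal hfin, hb', b.det_isUnitSMul, Finset.prod_inv_distrib, abs_inv]
  rw [hpre, measure_preimage_add_right, measure_preimage_equivFun μ b' hSm, hvol, hfd,
    ← ENNReal.ofReal_mul (by positivity)]
  congr 1
  field_simp

end

/-! ### Vertices, edge vectors and lattice index -/

section

variable {E : Type*} [NormedAddCommGroup E] [NormedSpace ℝ E]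

theorem IsConvexPolytope.convex {P : Set E} (hP : IsConvexPolytope P) : Convex ℝ P := by
  obtain ⟨-, H, rfl⟩ := hP
  intro x hx y hy s t hs ht hst h hh
  simp only [map_add, map_smul, smul_eq_mul]
  calc s * h.1 x + t * h.1 y ≤ s * h.2 + t * h.2 := by
        gcongr
        exacts [hx h hh, hy h hh]
    _ = h.2 := by rw [← add_mul, hst, one_mul]

theorem IsConvexPolytope.isCompact [FiniteDimensional ℝ E] {P : Set E}
    (hP : IsConvexPolytope P) : IsCompact P := by
  obtain ⟨hb, H, rfl⟩ := hP
  have := FiniteDimensional.proper ℝ E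
  refine Metric.isCompact_of_isClosed_isBounded ?_ hb
  have : {x : E | ∀ h ∈ H, h.1 x ≤ h.2} = ⋂ h ∈ H, {x | h.1 x ≤ h.2} := by ext; simp
  rw [this]
  exact isClosed_biInter fun h _ =>
    isClosed_le h.1.continuous_of_finiteDimensional continuous_const

open Filter Topology in
theorem IsConvexPolytope.finite_extremePoints {P : Set E} (hP : IsConvexPolytope P) :
    (P.extremePoints ℝ).Finite := by
  classical
  obtain ⟨-, H, rfl⟩ := hP
  -- an extreme point is determined by the constraints that are tight at it
  refine Set.Finite.of_finite_image (f := fun x => H.filter fun h => h.1 x = h.2)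
    (H.powerset.finite_toSet.subset ?_) ?_
  · rintro _ ⟨x, -, rfl⟩
    exact Finset.mem_coe.2 (Finset.mem_powerset.2 (Finset.filter_subset _ _))
  intro α hα β hβ hαβ
  have htight : ∀ h ∈ H, h.1 α = h.2 → h.1 (β - α) = 0 := by
    intro h hh he
    have : h ∈ H.filter fun h => h.1 β = h.2 := by
      rw [← show (H.filter fun h => h.1 α = h.2) = H.filter fun h => h.1 β = h.2 from hαβ]
      exact Finset.mem_filter.2 ⟨hh, he⟩
    rw [map_sub, he, (Finset.mem_filter.1 this).2, sub_self]
  -- The segment from `β` to `α` extends slightly beyond `α` inside the polytope: tight constraints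
  -- are constant along it and slack ones stay slack. Extremality of `α` then forces `β = α`.
  have hev : ∀ᶠ ε : ℝ in 𝓝[>] 0, ∀ h ∈ H, h.1 (α + (-ε) • (β - α)) ≤ h.2 := by
    refine (Finset.eventually_all H).2 fun h hh => ?_
    simp only [map_add, map_smul, smul_eq_mul]
    rcases (hα.1 h hh).eq_or_lt with he | hlt
    · simp [htight h hh he, he]
    · have hc : Continuous fun ε : ℝ => h.1 α + -ε * h.1 (β - α) := by fun_prop
      have := (hc.tendsto 0).mono_left (nhdsWithin_le_nhds (s := Set.Ioi 0))
      simp only [neg_zero, zero_mul, add_zero] at this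
      exact (this.eventually_lt_const hlt).mono fun _ => le_of_lt
  obtain ⟨ε, hε, hε0⟩ := (hev.and self_mem_nhdsWithin).exists
  have hε0 : 0 < ε := hε0
  refine ((mem_extremePoints.1 hα).2 _ hβ.1 _ hε ?_).1.symm
  refine ⟨ε / (1 + ε), 1 / (1 + ε), by positivity, by positivity, by field_simp; ring, ?_⟩
  have h1 : (1 + ε) ≠ 0 := by positivity
  have h2 : ∀ v w : E, (ε / (1 + ε)) • v + (1 / (1 + ε)) • w = (1 + ε)⁻¹ • (ε • v + w) := by
    intro v w; rw [smul_add, smul_smul]; congr 2 <;> field_simp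
  rw [h2, inv_smul_eq_iff₀ h1]
  module

variable {ι : Type*}

theorem mem_hull_range_iff [Finite ι] (b : Module.Basis ι ℝ E) (v : E) :
    v ∈ PointedCone.hull ℝ (Set.range b) ↔ ∀ i, 0 ≤ b.repr v i := by
  classical
  have := Fintype.ofFinite ι
  constructor
  · intro hv
    induction hv using Submodule.span_induction with
    | mem x hx =>
      obtain ⟨j, rfl⟩ := hx
      intro i
      rw [b.repr_self, Finsupp.single_apply]
      split_ifs <;> norm_num
    | zero => simp
    | add x y _ _ hx hy =>
      intro i
      rw [map_add, Finsupp.add_apply]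
      exact add_nonneg (hx i) (hy i)
    | smul a x _ hx =>
      intro i
      change 0 ≤ b.repr ((a : ℝ) • x) i
      rw [map_smul, Finsupp.smul_apply]
      exact mul_nonneg a.2 (hx i)
  · intro h
    rw [← b.sum_repr v]
    exact Submodule.sum_mem _ fun i _ =>
      PointedCone.smul_mem _ (h i) (Submodule.subset_span ⟨i, rfl⟩)

theorem mem_hull_singleton_iff {l x : E} :
    x ∈ PointedCone.hull ℝ {l} ↔ ∃ t : ℝ, 0 ≤ t ∧ t • l = x := by
  rw [PointedCone.hull, Submodule.mem_span_singleton]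
  exact ⟨fun ⟨a, h⟩ => ⟨a, a.2, h⟩, fun ⟨t, ht, h⟩ => ⟨⟨t, ht⟩, h⟩⟩

/-- The span of the generators contains `P - α`, which has interior, so independent generators form
a basis. -/
theorem exists_isConeBasis [FiniteDimensional ℝ E] {n : ℕ} (hn : Module.finrank ℝ E = n)
    {P : Set E} (hint : (interior P).Nonempty) {α : E} (hs : (tangentCone P α).IsSimplicial) :
    ∃ b : Module.Basis (Fin n) ℝ E, IsConeBasis P α b := by
  obtain ⟨s, hfin, hli, hs⟩ := hs
  have hspan : Submodule.span ℝ s = ⊤ := by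
    refine Submodule.eq_top_of_nonempty_interior' _ ?_
    have hsub : (fun v => v - α) '' P ⊆ (Submodule.span ℝ s : Set E) := by
      rintro _ ⟨v, hv, rfl⟩
      have h1 : v - α ∈ PointedCone.hull ℝ s := hs ▸ sub_mem_tangentCone hv
      exact (Submodule.span_subset_span {r : ℝ // 0 ≤ r} ℝ s) h1
    refine Set.Nonempty.mono (interior_mono hsub) ?_
    have := (Homeomorph.subRight α).image_interior P
    simp only [Homeomorph.coe_subRight] at this
    rw [← this]
    exact hint.image _
  have : Finite s := hfin
  have := Fintype.ofFinite s
  let b₀ : Module.Basis s ℝ E := Module.Basis.mk (v := ((↑) : s → E)) hli (by simp [hspan])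
  have hcard : Fintype.card s = n := by rw [← hn, Module.finrank_eq_card_basis b₀]
  let b := b₀.reindex (Fintype.equivFinOfCardEq hcard)
  refine ⟨b, fun v => ?_⟩
  have hrange : Set.range b = s := by
    rw [Module.Basis.range_reindex, show (b₀ : s → E) = (↑) from Module.Basis.coe_mk _ _,
      Subtype.range_coe]
  rw [← mem_hull_range_iff, ← hs, hrange]

/-- The edge in direction `b i` ends at another vertex `β`, and `β - α` is a lattice vector. -/
theorem IsConeBasis.exists_pos_smul_mem [FiniteDimensional ℝ E] [Fintype ι] {L : Submodule ℤ E}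
    {P : Set E} (hPc : IsCompact P) (hP : Convex ℝ P) (hL : P.extremePoints ℝ ⊆ L) {α : E}
    (hα : α ∈ P.extremePoints ℝ) {b : Module.Basis ι ℝ E} (hb : IsConeBasis P α b) (i : ι) :
    ∃ r : ℝ, 0 < r ∧ r • b i ∈ L := by
  have hF := isFace_faceAt hP hPc.isClosed hα.1 hb {i}
  obtain ⟨ε, hε, hm⟩ := mem_faceDirections.1 (show i ∈ faceDirections b α (faceAt P α b {i}) by
    rw [faceDirections_faceAt hP hα.1 hb]; simp)
  obtain ⟨β, hβ, hβF, hmax⟩ := hF.exists_vertex hPc (b.coord i)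
  have hsub : β - α = b.repr (β - α) i • b i := by
    refine b.ext_elem fun j => ?_
    by_cases hj : j = i
    · subst hj; rw [map_smul, Finsupp.smul_apply, b.repr_self]; simp
    · rw [hβF.2 j (by simpa using hj), map_smul, Finsupp.smul_apply, b.repr_self,
        Finsupp.single_eq_of_ne hj, smul_zero]
  refine ⟨b.repr (β - α) i, ?_, ?_⟩
  · have := hmax _ hm
    simp only [b.coord_apply, map_add, map_smul, b.repr_self, Finsupp.add_apply,
      Finsupp.smul_apply, Finsupp.single_eq_same, smul_eq_mul, mul_one] at this
    rw [map_sub, Finsupp.sub_apply]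
    linarith
  · rw [← hsub]
    exact L.sub_mem (hL hβ) (hL hα)

theorem exists_primitive_smul [FiniteDimensional ℝ E] (L : Submodule ℤ E) [DiscreteTopology L]
    {v : E} (hv : v ≠ 0) (h : ∃ r : ℝ, 0 < r ∧ r • v ∈ L) :
    ∃ r : ℝ, 0 < r ∧ r • v ∈ L ∧ ∀ s : ℝ, 0 < s → s • v ∈ L → r ≤ s := by
  obtain ⟨r₀, hr₀, hm⟩ := h
  have := FiniteDimensional.proper ℝ E
  have hfin : {r : ℝ | 0 < r ∧ r ≤ r₀ ∧ r • v ∈ L}.Finite := by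
    refine Set.Finite.of_finite_image (f := fun r : ℝ => r • v) ?_
      ((smul_left_injective ℝ hv).injOn)
    have : DiscreteTopology L.toAddSubgroup := ‹DiscreteTopology L›
    refine (Metric.finite_isBounded_inter_isClosed
      (isDiscrete_iff_discreteTopology.2 ‹DiscreteTopology L.toAddSubgroup›)
      (Metric.isBounded_closedBall (x := (0 : E)) (r := r₀ * ‖v‖))
      (AddSubgroup.isClosed_of_discrete (H := L.toAddSubgroup))).subset ?_
    rintro _ ⟨r, ⟨h0, h1, h2⟩, rfl⟩
    refine ⟨?_, h2⟩
    rw [mem_closedBall_zero_iff, norm_smul, Real.norm_of_nonneg h0.le]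
    gcongr
  obtain ⟨r, ⟨h0, h1, h2⟩, hmin⟩ := Set.exists_min_image _ id hfin ⟨r₀, hr₀, le_rfl, hm⟩
  refine ⟨r, h0, h2, fun s hs hsL => ?_⟩
  by_contra! hlt
  exact hlt.not_ge (hmin s ⟨hs, hlt.le.trans h1, hsL⟩)

theorem IsConeBasis.range_eq_edgeVectors {L : Submodule ℤ E} {P : Set E} {α : E}
    {b : Module.Basis ι ℝ E} (hb : IsConeBasis P α b) (hL : ∀ i, b i ∈ L)
    (hprim : ∀ i, ∀ s : ℝ, 0 < s → s • b i ∈ L → 1 ≤ s) :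
    Set.range b = edgeVectors L P α := by
  classical
  have hmem : ∀ i, b i ∈ tangentCone P α := by
    intro i
    rw [hb]; intro j
    rw [b.repr_self, Finsupp.single_apply]
    split_ifs <;> norm_num
  apply Set.Subset.antisymm
  · rintro _ ⟨i, rfl⟩
    refine ⟨hL i, b.ne_zero i, ⟨?_, ?_⟩, hprim i⟩
    · intro x hx
      obtain ⟨t, ht, rfl⟩ := mem_hull_singleton_iff.1 hx
      exact PointedCone.smul_mem _ ht (hmem i)
    · intro x y a hx hy ha hxy
      obtain ⟨t, ht, hxy⟩ := mem_hull_singleton_iff.1 hxy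
      rw [hb] at hx hy
      refine mem_hull_singleton_iff.2 ⟨b.repr x i, hx i, b.ext_elem fun j => ?_⟩
      rw [map_smul, Finsupp.smul_apply, b.repr_self, Finsupp.single_apply]
      split_ifs with hij
      · subst hij; simp
      · have h1 := congrArg (fun v => b.repr v j) hxy
        simp only [map_smul, map_add, Finsupp.smul_apply, Finsupp.add_apply, b.repr_self,
          Finsupp.single_apply, hij, if_false, smul_eq_mul, mul_zero] at h1
        have h2 := mul_nonneg ha.le (hx j)
        have h3 : a * b.repr x j = 0 := by linarith [hy j]
        rw [smul_zero, (mul_eq_zero.1 h3).resolve_left ha.ne']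
  · rintro l ⟨hlL, hl0, hface, hlprim⟩
    have hl : l ∈ tangentCone P α := hface.le (Submodule.subset_span rfl)
    have hlr := (hb l).1 hl
    obtain ⟨i, hi⟩ : ∃ i, b.repr l i ≠ 0 := by
      by_contra! h
      exact hl0 (b.ext_elem fun i => by simp [h i])
    have hpos := lt_of_le_of_ne (hlr i) hi.symm
    -- The face property puts the summand `b i` on the ray of `l`; primitivity of both vectors then
    -- makes them equal.
    have hrest : l - b.repr l i • b i ∈ tangentCone P α := by
      rw [hb]; intro j
      rw [map_sub, map_smul, b.repr_self, Finsupp.sub_apply, Finsupp.smul_apply,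
        Finsupp.single_apply]
      split_ifs with h
      · subst h; simp
      · simpa using hlr j
    have hbi := hface.mem_of_smul_add_mem (hmem i) hrest hpos
      (by rw [add_sub_cancel]; exact Submodule.subset_span rfl)
    obtain ⟨t, ht, hbt⟩ := mem_hull_singleton_iff.1 hbi
    have ht0 : 0 < t := lt_of_le_of_ne ht fun h => b.ne_zero i (by rw [← hbt, ← h, zero_smul])
    have h1 : 1 ≤ t := hlprim t ht0 (by rw [hbt]; exact hL i)
    have h2 : 1 ≤ t⁻¹ := hprim i t⁻¹ (by positivity) (by rwa [← hbt, inv_smul_smul₀ ht0.ne'])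
    have h3 : t = 1 := le_antisymm ((one_le_inv₀ ht0).1 h2) h1
    exact ⟨i, by rw [← hbt, h3, one_smul]⟩

/-- At a vertex of a simple lattice polytope the edge vectors form a basis spanning the tangent
cone. -/
theorem IsSimpleLatticePolytope.exists_edgeBasis [FiniteDimensional ℝ E] {n : ℕ}
    (hn : Module.finrank ℝ E = n) {L : Submodule ℤ E} [DiscreteTopology L] {P : Set E}
    (hP : IsSimpleLatticePolytope L P) {α : E} (hα : α ∈ P.extremePoints ℝ) :
    ∃ b : Module.Basis (Fin n) ℝ E, IsConeBasis P α b ∧ Set.range b = edgeVectors L P α := by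
  obtain ⟨b, hb⟩ := exists_isConeBasis hn hP.nonempty_interior (hP.isSimplicial α hα)
  choose r hr0 hrL hmin using fun i => exists_primitive_smul L (b.ne_zero i)
    (hb.exists_pos_smul_mem hP.isConvexPolytope.isCompact hP.isConvexPolytope.convex
      hP.extremePoints_subset hα i)
  set b' := b.isUnitSMul (w := r) fun i => (hr0 i).ne'.isUnit with hb'
  have hb'i : ∀ i, b' i = r i • b i := fun i => b.isUnitSMul_apply _ i
  have hcone : IsConeBasis P α b' := by
    intro v
    rw [hb v]
    refine forall_congr' fun i => ?_
    have : b.repr v i = r i * b'.repr v i := by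
      conv_lhs => rw [← b'.sum_repr v]
      simp [hb'i, Finsupp.single_apply, mul_comm]
    rw [this, mul_nonneg_iff_of_pos_left (hr0 i)]
  refine ⟨b', hcone, hcone.range_eq_edgeVectors (fun i => hb'i i ▸ hrL i) fun i s hs hsL => ?_⟩
  rw [hb'i, smul_smul] at hsL
  have := hmin i _ (mul_pos hs (hr0 i)) hsL
  exact (le_mul_iff_one_le_left (hr0 i)).1 this

theorem unitParallelepiped_eq_fundamentalDomain [Finite ι] {L : Submodule ℤ E} {P : Set E} {α : E}
    {b : Module.Basis ι ℝ E} (hb : Set.range b = edgeVectors L P α) :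
    unitParallelepiped L P α = ZSpan.fundamentalDomain b := by
  have := Fintype.ofFinite ι
  have hsum : ∀ a : E → ℝ, ∑ᶠ l ∈ edgeVectors L P α, a l • l = ∑ i, a (b i) • b i := by
    intro a
    rw [← hb, finsum_mem_range b.injective, finsum_eq_sum_of_fintype]
  ext x
  rw [ZSpan.mem_fundamentalDomain]
  constructor
  · rintro ⟨a, ha, rfl⟩ i
    rw [hsum, b.repr_sum_self]
    exact ha _
  · intro h
    refine ⟨Function.extend b (b.repr x) 0, fun l => ?_, ?_⟩
    · by_cases hl : ∃ i, b i = l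
      · obtain ⟨i, rfl⟩ := hl
        rw [b.injective.extend_apply]
        exact h i
      · rw [Function.extend_apply' _ _ _ hl]
        simp
    · rw [hsum]
      simp_rw [b.injective.extend_apply]
      exact (b.sum_repr x).symm

theorem span_range_le {L : Submodule ℤ E} {b : Module.Basis ι ℝ E} (hL : ∀ i, b i ∈ L) :
    Submodule.span ℤ (Set.range b) ≤ L := by
  rw [Submodule.span_le]
  rintro _ ⟨i, rfl⟩
  exact hL i

/-- Each coset of the sublattice has exactly one representative in the half-open parallelepiped,
given by `ZSpan.fract`. -/
theorem card_quotient_span_range [Finite ι] {L : Submodule ℤ E} {b : Module.Basis ι ℝ E}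
    (hL : ∀ i, b i ∈ L) :
    Nat.card (L ⧸ (Submodule.span ℤ (Set.range b)).submoduleOf L) =
      (ZSpan.fundamentalDomain b ∩ (L : Set E)).ncard := by
  have := Fintype.ofFinite ι
  rw [← Nat.card_coe_set_eq]
  symm
  refine Nat.card_eq_of_bijective (fun q : ↥(ZSpan.fundamentalDomain b ∩ (L : Set E)) =>
    (Submodule.Quotient.mk (⟨q, q.2.2⟩ : L) : L ⧸ _)) ⟨?_, ?_⟩
  · rintro ⟨x, hx, hxL⟩ ⟨y, hy, hyL⟩ hxy
    have h0 := (Submodule.Quotient.eq ((Submodule.span ℤ (Set.range b)).submoduleOf L)).1 hxy.symm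
    have h1 : y - x ∈ Submodule.span ℤ (Set.range b) := h0
    rw [sub_eq_neg_add] at h1
    have h2 := (ZSpan.fract_eq_fract b x y).2 h1
    rw [ZSpan.fract_eq_self.2 hx, ZSpan.fract_eq_self.2 hy] at h2
    exact Subtype.ext h2
  · intro q
    obtain ⟨⟨x, hx⟩, rfl⟩ := Submodule.Quotient.mk_surjective _ q
    have hfl : (ZSpan.floor b x : E) ∈ L := span_range_le hL (ZSpan.floor b x).2
    refine ⟨⟨ZSpan.fract b x, ZSpan.fract_mem_fundamentalDomain b x, L.sub_mem hx hfl⟩, ?_⟩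
    refine ((Submodule.Quotient.eq _).2 ?_).symm
    change x - ZSpan.fract b x ∈ Submodule.span ℤ (Set.range b)
    rw [ZSpan.fract_apply, sub_sub_cancel]
    exact (ZSpan.floor b x).2

theorem natAbs_det_eq_ncard [Fintype ι] [DecidableEq ι] {L : Submodule ℤ E}
    (c : Module.Basis ι ℤ L) {b : Module.Basis ι ℝ E} (hL : ∀ i, b i ∈ L) :
    (c.det fun i => ⟨b i, hL i⟩).natAbs = (ZSpan.fundamentalDomain b ∩ (L : Set E)).ncard := by
  have := Module.Free.of_basis c
  have := Module.Finite.of_basis c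
  rw [← card_quotient_span_range hL, ← Submodule.natAbs_det_basis_change c _
    ((b.restrictScalars ℤ).map (Submodule.submoduleOfEquivOfLe (span_range_le hL)).symm)]
  congr 2
  ext i
  exact (b.restrictScalars_apply ℤ i).symm

theorem measureReal_fundamentalDomain_eq [FiniteDimensional ℝ E] [MeasurableSpace E]
    [BorelSpace E] {n : ℕ} (L : Submodule ℤ E) [DiscreteTopology L] [IsZLattice ℝ L]
    (μ : Measure E) [μ.IsAddHaarMeasure] {b : Module.Basis (Fin n) ℝ E} (hL : ∀ i, b i ∈ L) :
    μ.real (ZSpan.fundamentalDomain b) =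
      (ZSpan.fundamentalDomain b ∩ (L : Set E)).ncard * ZLattice.covolume L μ := by
  have hrank : Module.finrank ℤ L = n := by
    rw [ZLattice.rank ℝ L, Module.finrank_eq_card_basis b, Fintype.card_fin]
  have := ZLattice.module_free ℝ L
  have := ZLattice.module_finite ℝ L
  obtain ⟨c⟩ : Nonempty (Module.Basis (Fin n) ℤ L) := ⟨Module.finBasisOfFinrankEq ℤ L hrank⟩
  rw [ZLattice.covolume_eq_measure_fundamentalDomain L μ (ZLattice.isAddFundamentalDomain c μ),
    ZSpan.measureReal_fundamentalDomain b μ (c.ofZLatticeBasis ℝ L), ← natAbs_det_eq_ncard c hL,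
    Nat.cast_natAbs, Int.cast_abs]
  congr 2
  rw [Module.Basis.det_apply, Module.Basis.det_apply, Int.cast_det]
  congr 1
  ext i j
  rw [Matrix.map_apply, Module.Basis.toMatrix_apply, Module.Basis.toMatrix_apply]
  exact c.ofZLatticeBasis_repr_apply ℝ L ⟨b j, hL j⟩ i

end

/-! ### Assembling the volume formula -/

section

variable {E : Type*} [NormedAddCommGroup E] [NormedSpace ℝ E] [FiniteDimensional ℝ E]
  [MeasurableSpace E] [BorelSpace E]

theorem measurableSet_flippedCone {ι : Type*} [Finite ι] (α : E) (b : Module.Basis ι ℝ E)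
    (ζ : Module.Dual ℝ E) : MeasurableSet (flippedCone α b ζ) := by
  have h1 : flippedCone α b ζ = ⋂ i, {x | b.coord i (x - α) < 0 ↔ ζ (b i) < 0} := by
    ext x; simp [flippedCone]
  rw [h1]
  refine MeasurableSet.iInter fun i => ?_
  have hc : Continuous fun x => b.coord i (x - α) :=
    (b.coord i).continuous_of_finiteDimensional.comp (by fun_prop)
  have h2 : MeasurableSet {x | b.coord i (x - α) < 0} :=
    measurableSet_lt hc.measurable measurable_const
  by_cases h : ζ (b i) < 0
  · simpa only [h, iff_true] using h2
  · simp only [h, iff_false]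
    exact h2.compl

open Finset in
theorem neg_one_pow_card_div_abs_prod {ι : Type*} [Fintype ι] (f : ι → ℝ) (hf : ∀ i, f i ≠ 0) :
    (-1 : ℝ) ^ #{i | f i < 0} / |∏ i, f i| = 1 / ∏ i, f i := by
  have h1 : (-1 : ℝ) ^ #{i | f i < 0} = ∏ i, if f i < 0 then (-1 : ℝ) else 1 := by
    rw [prod_ite, prod_const, prod_const_one, mul_one]
  rw [h1, abs_prod, ← prod_div_distrib, one_div, ← prod_inv_distrib]
  refine prod_congr rfl fun i _ => ?_
  have := hf i
  split_ifs with h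
  · rw [abs_of_neg h, neg_div_neg_eq, one_div]
  · rw [abs_of_nonneg (not_lt.1 h), one_div]

open Finset in
/-- The volume of a simple polytope as the signed sum of the volumes of its truncated flipped
vertex cones. -/
theorem measureReal_eq_sum_of_le {n : ℕ} (μ : Measure E) [μ.IsAddHaarMeasure] {P : Set E}
    (hPc : IsCompact P) (hP : Convex ℝ P) (hfin : (P.extremePoints ℝ).Finite)
    {b : E → Module.Basis (Fin n) ℝ E}
    (hb : ∀ α ∈ P.extremePoints ℝ, IsConeBasis P α (b α)) {ζ : Module.Dual ℝ E}
    (hζ : ∀ α ∈ P.extremePoints ℝ, ∀ i, ζ (b α i) ≠ 0) {c : ℝ} (hc : ∀ x ∈ P, ζ x ≤ c) :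
    μ.real P = ∑ α ∈ hfin.toFinset, μ.real (ZSpan.fundamentalDomain (b α)) * (c - ζ α) ^ n /
      (n.factorial * ∏ i, ζ (b α i)) := by
  have hH : MeasurableSet {x | ζ x ≤ c} :=
    measurableSet_le ζ.continuous_of_finiteDimensional.measurable measurable_const
  set A : E → Set E := fun α => flippedCone α (b α) ζ ∩ {x | ζ x ≤ c} with hA
  have hAm : ∀ α, MeasurableSet (A α) := fun α => (measurableSet_flippedCone _ _ _).inter hH
  have hAμ : ∀ α ∈ P.extremePoints ℝ, μ (A α) = ENNReal.ofReal
      (μ.real (ZSpan.fundamentalDomain (b α)) * (c - ζ α) ^ n /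
        (n.factorial * |∏ i, ζ (b α i)|)) := fun α hα =>
    measure_flippedCone_inter μ (b α) (hζ α hα) α (hc α hα.1)
  have hpt : ∀ x, P.indicator (1 : E → ℝ) x = ∑ α ∈ hfin.toFinset,
      (A α).indicator (fun _ => (-1 : ℝ) ^ #{i | ζ (b α i) < 0}) x := by
    intro x
    by_cases hx : ζ x ≤ c
    · rw [← sum_indicator_flippedCone hPc hP hfin hb hζ x]
      refine sum_congr rfl fun α _ => ?_
      by_cases h : x ∈ flippedCone α (b α) ζ
      · rw [Set.indicator_of_mem h, Set.indicator_of_mem (show x ∈ A α from ⟨h, hx⟩)]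
      · rw [Set.indicator_of_notMem h, Set.indicator_of_notMem fun h' : x ∈ A α => h h'.1]
    · rw [Set.indicator_of_notMem fun h => hx (hc x h)]
      exact (sum_eq_zero fun α _ => Set.indicator_of_notMem (fun h : x ∈ A α => hx h.2) _).symm
  rw [← integral_indicator_one hPc.measurableSet, integral_congr_ae (.of_forall hpt),
    integral_finsetSum]
  · refine sum_congr rfl fun α hα => ?_
    rw [hfin.mem_toFinset] at hα
    have hcα := sub_nonneg.2 (hc α hα.1)
    rw [integral_indicator_const _ (hAm α), measureReal_def, hAμ α hα,
      ENNReal.toReal_ofReal (by positivity), smul_eq_mul]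
    have h := neg_one_pow_card_div_abs_prod (fun i => ζ (b α i)) (hζ α hα)
    calc _ = μ.real (ZSpan.fundamentalDomain (b α)) * (c - ζ α) ^ n / n.factorial *
          ((-1 : ℝ) ^ #{i | ζ (b α i) < 0} / |∏ i, ζ (b α i)|) := by
            rw [div_mul_eq_div_div, div_mul_eq_mul_div, mul_div_assoc]
      _ = _ := by rw [h, div_mul_eq_div_div, mul_one_div]
  · intro α hα
    rw [hfin.mem_toFinset] at hα
    refine (integrable_indicator_iff (hAm α)).2 (integrableOn_const ?_)
    rw [hAμ α hα]
    exact ENNReal.ofReal_ne_top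

open Finset Polynomial in
theorem measureReal_eq_sum {n : ℕ} (μ : Measure E) [μ.IsAddHaarMeasure] {P : Set E}
    (hPc : IsCompact P) (hP : Convex ℝ P) (hfin : (P.extremePoints ℝ).Finite)
    {b : E → Module.Basis (Fin n) ℝ E}
    (hb : ∀ α ∈ P.extremePoints ℝ, IsConeBasis P α (b α)) {ζ : Module.Dual ℝ E}
    (hζ : ∀ α ∈ P.extremePoints ℝ, ∀ i, ζ (b α i) ≠ 0) :
    μ.real P = (-1) ^ n / n.factorial * ∑ α ∈ hfin.toFinset,
      ζ α ^ n * μ.real (ZSpan.fundamentalDomain (b α)) / ∏ i, ζ (b α i) := by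
  obtain ⟨c₀, hc₀⟩ := hPc.bddAbove_image ζ.continuous_of_finiteDimensional.continuousOn
  let p : ℝ[X] := ∑ α ∈ hfin.toFinset, C (μ.real (ZSpan.fundamentalDomain (b α)) /
    (n.factorial * ∏ i, ζ (b α i))) * (X - C (ζ α)) ^ n
  have hp : ∀ c, p.eval c = ∑ α ∈ hfin.toFinset, μ.real (ZSpan.fundamentalDomain (b α)) /
      (n.factorial * ∏ i, ζ (b α i)) * (c - ζ α) ^ n := by
    intro c
    simp [p, eval_finsetSum]
  -- The truncation level `c` is arbitrary above `c₀`, so the polynomial is constant; below,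
  -- evaluation at 0 removes `c`.
  have heq : p = C (μ.real P) := by
    refine Polynomial.eq_of_infinite_eval_eq _ _ ((Set.Ici_infinite c₀).mono fun c hc => ?_)
    have hc : c₀ ≤ c := hc
    rw [Set.mem_ofPred_eq, eval_C, hp, measureReal_eq_sum_of_le μ hPc hP hfin hb hζ
      (c := c) fun x hx => (hc₀ ⟨x, hx, rfl⟩).trans hc]
    exact sum_congr rfl fun α _ => by ring
  have h0 := hp 0
  rw [heq, eval_C] at h0
  rw [h0, mul_sum]
  refine sum_congr rfl fun α _ => ?_
  rw [zero_sub, neg_pow, div_mul_eq_div_div]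
  ring

end

end LatticePolytope

/-- `L` is the lattice `M` in `E = M_ℝ`, `ζ` is a point of `N_ℝ = (M_ℝ)^*`, and `μ` is the Haar
measure `vol_n` normalised so that a fundamental domain of the lattice has volume `1`. The first
two conjuncts say that the sums, products and cardinalities in the formula are over finite sets. -/
theorem mainTheorem4 {E : Type*} [NormedAddCommGroup E] [NormedSpace ℝ E] [FiniteDimensional ℝ E]
    [MeasurableSpace E] [BorelSpace E] (n : ℕ) (hn : Module.finrank ℝ E = n)
    (L : Submodule ℤ E) [DiscreteTopology L] [IsZLattice ℝ L]
    (μ : Measure E) [μ.IsAddHaarMeasure] (hμ : ZLattice.covolume L μ = 1)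
    (P : Set E) (hP : LatticePolytope.IsSimpleLatticePolytope L P)
    (ζ : Module.Dual ℝ E) (hζ : LatticePolytope.IsGeneric L P ζ) :
    (P.extremePoints ℝ).Finite ∧
    (∀ α ∈ P.extremePoints ℝ, (LatticePolytope.edgeVectors L P α).encard = n ∧
      (LatticePolytope.unitParallelepiped L P α ∩ (L : Set E)).Finite) ∧
    μ.real P = (-1) ^ n / (n.factorial : ℝ) *
      ∑ᶠ α ∈ P.extremePoints ℝ,
        (ζ α) ^ n * (LatticePolytope.singularityOrder L P α : ℝ) /
          ∏ᶠ l ∈ LatticePolytope.edgeVectors L P α, ζ l := by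
  have hPc := hP.isConvexPolytope.isCompact
  have hfin := hP.isConvexPolytope.finite_extremePoints
  have hex : ∀ α, ∃ b : Module.Basis (Fin n) ℝ E, α ∈ P.extremePoints ℝ →
      LatticePolytope.IsConeBasis P α b ∧ Set.range b = LatticePolytope.edgeVectors L P α := by
    intro α
    by_cases hα : α ∈ P.extremePoints ℝ
    · obtain ⟨b, hb⟩ := hP.exists_edgeBasis hn hα
      exact ⟨b, fun _ => hb⟩
    -- Arbitrary basis away from the vertices, so that `b` is a total function.
    · exact ⟨Module.finBasisOfFinrankEq ℝ E hn, fun h => absurd h hα⟩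
  choose b hb using hex
  have hmem : ∀ α ∈ P.extremePoints ℝ, ∀ i, b α i ∈ LatticePolytope.edgeVectors L P α :=
    fun α hα i => (hb α hα).2 ▸ Set.mem_range_self i
  refine ⟨hfin, fun α hα => ⟨?_, ?_⟩, ?_⟩
  · rw [← (hb α hα).2, ← Set.image_univ, (b α).injective.encard_image]
    simp
  · rw [LatticePolytope.unitParallelepiped_eq_fundamentalDomain (hb α hα).2]
    have := FiniteDimensional.proper ℝ E
    have : DiscreteTopology L.toAddSubgroup := ‹DiscreteTopology L›
    exact Metric.finite_isBounded_inter_isClosed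
      (isDiscrete_iff_discreteTopology.2 ‹DiscreteTopology L.toAddSubgroup›)
      (ZSpan.fundamentalDomain_isBounded (b α))
      (AddSubgroup.isClosed_of_discrete (H := L.toAddSubgroup))
  · rw [LatticePolytope.measureReal_eq_sum μ hPc hP.isConvexPolytope.convex hfin
      (fun α hα => (hb α hα).1) fun α hα i => hζ α hα _ (hmem α hα i),
      finsum_mem_eq_finite_toFinset_sum _ hfin]
    congr 1
    refine Finset.sum_congr rfl fun α hα => ?_
    rw [hfin.mem_toFinset] at hα
    rw [LatticePolytope.measureReal_fundamentalDomain_eq L μ fun i => (hmem α hα i).1, hμ, mul_one,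
      LatticePolytope.singularityOrder,
      LatticePolytope.unitParallelepiped_eq_fundamentalDomain (hb α hα).2, ← (hb α hα).2,
      finprod_mem_range (b α).injective, finprod_eq_prod_of_fintype]
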